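/- Let $\mathbb{F}$ be an arbitrary field. An \emph{ACI-matrix} over $\mathbb{F}$ is a matrix whose entries are polynomials of degree at most one over $\mathbb{F}$ in some indeterminates, such that no indeterminate appears in two different columns. A \emph{completion} of it is the matrix over $\mathbb{F}$ obtained by assigning values in $\mathbb{F}$ to the indeterminates, and it has \emph{constant rank} $\rho$ if all its completions have rank $\rho$. Two $m\times n$ ACI-matrices $A$ and $B$ are \emph{equivalent}, $A\sim B$, if $TAQ=B$ for some nonsingular $m\times m$ matrix $T$ over $\mathbb{F}$ and some $n\times n$ permutation matrix $Q$. An ACI-matrix of constant rank $\rho$ is \emph{irreducible} if no matrix obtained from it by deleting a single row or a single column has constant rank $\rho$, and \emph{completely irreducible} if every ACI-matrix equivalent to it is irreducible. (Matrices with no rows or no columns are allowed; they have rank $0$.) Lemma. Every ACI-matrix $A$ of constant rank $\rho$ over $\mathbb{F}$ has a core: there is a completely irreducible ACI-matrix $A'$ of constant rank $\rho$ such that $$A\sim\begin{bmatrix} A' & * \\ * & * \end{bmatrix},$$ where the blocks other than $A'$ may be void. -/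

import Mathlib

namespace ACI

variable {F σ m n : Type*} [Field F]

/-- A matrix over `F[x_s : s ∈ σ]` is an ACI-matrix if its entries are polynomials of degree at
most one and no indeterminate appears in two different columns. -/
def IsACI (A : Matrix m n (MvPolynomial σ F)) : Prop :=
  (∀ i j, (A i j).totalDegree ≤ 1) ∧
    ∀ i i' j j', j ≠ j' → Disjoint (A i j).vars (A i' j').vars

/-- The completion of `A` given by assigning the value `x s` to each indeterminate `s`. -/
noncomputable def completion (A : Matrix m n (MvPolynomial σ F)) (x : σ → F) : Matrix m n F :=
  A.map (MvPolynomial.eval x)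

/-- The rank of `A`: the set of all ranks of completions of `A`. -/
def rankSet [Fintype n] (A : Matrix m n (MvPolynomial σ F)) : Set ℕ :=
  {r | ∃ x : σ → F, (completion A x).rank = r}

/-- `A` has constant rank `ρ`. -/
def HasConstantRank [Fintype n] (A : Matrix m n (MvPolynomial σ F)) (ρ : ℕ) : Prop :=
  rankSet A = {ρ}

/-- `A ∼ B`: there are a nonsingular constant matrix `T` and a permutation matrix `Q` such that
`T A Q = B`. -/
def Equivalent [Fintype m] [DecidableEq m] [Fintype n] [DecidableEq n]
    (A B : Matrix m n (MvPolynomial σ F)) : Prop :=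
  ∃ (T : Matrix m m F) (q : Equiv.Perm n), IsUnit T ∧
    (T.map MvPolynomial.C : Matrix m m (MvPolynomial σ F)) * A *
      (q.permMatrix (MvPolynomial σ F) : Matrix n n (MvPolynomial σ F)) = B

/-- The matrix obtained from `A` by deleting the row `i`. -/
def deleteRow (A : Matrix m n (MvPolynomial σ F)) (i : m) :
    Matrix {k : m // k ≠ i} n (MvPolynomial σ F) :=
  A.submatrix Subtype.val id

/-- The matrix obtained from `A` by deleting the column `j`. -/
def deleteCol (A : Matrix m n (MvPolynomial σ F)) (j : n) :
    Matrix m {k : n // k ≠ j} (MvPolynomial σ F) :=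
  A.submatrix id Subtype.val

/-- Row reducibility of a matrix `A` of constant rank `ρ`. -/
def RowReducible [Fintype n] (A : Matrix m n (MvPolynomial σ F)) (ρ : ℕ) : Prop :=
  HasConstantRank A ρ ∧ ∃ i, HasConstantRank (deleteRow A i) ρ

/-- Column reducibility of a matrix `A` of constant rank `ρ`. -/
def ColReducible [Fintype n] [DecidableEq n] (A : Matrix m n (MvPolynomial σ F)) (ρ : ℕ) : Prop :=
  HasConstantRank A ρ ∧ ∃ j, HasConstantRank (deleteCol A j) ρ

/-- `A` is an irreducible ACI-matrix of constant rank `ρ`. -/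
def IsIrreducible [Fintype n] [DecidableEq n] (A : Matrix m n (MvPolynomial σ F)) (ρ : ℕ) : Prop :=
  IsACI A ∧ HasConstantRank A ρ ∧ ¬ RowReducible A ρ ∧ ¬ ColReducible A ρ

/-- `A` is a completely irreducible ACI-matrix of constant rank `ρ`: every ACI-matrix equivalent
to `A` is irreducible. -/
def IsCompletelyIrreducible [Fintype m] [DecidableEq m] [Fintype n] [DecidableEq n]
    (A : Matrix m n (MvPolynomial σ F)) (ρ : ℕ) : Prop :=
  IsACI A ∧ HasConstantRank A ρ ∧ ∀ B, IsACI B → Equivalent A B → IsIrreducible B ρ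

/-- `A'` is the upper left `m' × n'` block of the `m × n` matrix `B`. -/
def IsUpperLeftBlock {m n m' n' : ℕ} (A' : Matrix (Fin m') (Fin n') (MvPolynomial σ F))
    (B : Matrix (Fin m) (Fin n) (MvPolynomial σ F)) : Prop :=
  ∃ (hm : m' ≤ m) (hn : n' ≤ n), A' = B.submatrix (Fin.castLE hm) (Fin.castLE hn)

/-- `A'` is a core of the matrix `A` of constant rank `ρ`: `A` is equivalent to an ACI-matrix with
upper left block `A'`, and `A'` is completely irreducible of constant rank `ρ`. -/
def IsCore {m n m' n' : ℕ} (A' : Matrix (Fin m') (Fin n') (MvPolynomial σ F))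
    (A : Matrix (Fin m) (Fin n) (MvPolynomial σ F)) (ρ : ℕ) : Prop :=
  (∃ B, IsACI B ∧ Equivalent A B ∧ IsUpperLeftBlock A' B) ∧ IsCompletelyIrreducible A' ρ

end ACI

/-!
Passing to `R A`, where the rows of the constant matrix `R` are independent, and then to some of
the columns is a transitive operation on ACI-matrices, and both equivalence and the deletion of a
row or a column are instances of it. Among the matrices of constant rank `ρ` obtained from `A` in
this way, one with the least total number of rows and columns is completely irreducible: an
equivalence followed by a deletion would give a smaller one. It is a block of a matrix equivalent
to `A`, because `R` can be completed to a nonsingular matrix and the choice of columns to a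
permutation.
-/

namespace ACI

theorem exists_linearEquiv_forall_apply_eq {K V ι : Type*} [DivisionRing K] [AddCommGroup V]
    [Module K V] [Finite ι] {v w : ι → V} (hv : LinearIndependent K v)
    (hw : LinearIndependent K w) : ∃ g : V ≃ₗ[K] V, ∀ i, g (v i) = w i := by
  have : FiniteDimensional K (Submodule.span K (Set.range v)) :=
    FiniteDimensional.span_of_finite K (Set.finite_range v)
  let f := hv.linearCombinationEquiv.symm.trans hw.linearCombinationEquiv
  obtain ⟨g, hg⟩ := Submodule.exists_linearEquiv_restrict_eq f
  refine ⟨g, fun i => ?_⟩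
  have hf : f (hv.linearCombinationEquiv (Finsupp.single i 1)) =
      hw.linearCombinationEquiv (Finsupp.single i 1) := by
    simp only [f, LinearEquiv.trans_apply, LinearEquiv.symm_apply_apply]
  simpa [hf] using (hg (hv.linearCombinationEquiv (Finsupp.single i 1))).symm

theorem exists_isUnit_submatrix_eq {K m m' : Type*} [Field K] [Fintype m] [DecidableEq m]
    {R : Matrix m' m K} (hR : LinearIndependent K R.row) {r : m' → m}
    (hr : Function.Injective r) :
    ∃ T : Matrix m m K, IsUnit T ∧ T.submatrix r id = R := by
  have : Finite m' := Finite.of_injective r hr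
  have he : LinearIndependent K (Pi.basisFun K m) := (Pi.basisFun K m).linearIndependent
  obtain ⟨g, hg⟩ := exists_linearEquiv_forall_apply_eq (he.comp r hr) hR
  refine ⟨Matrix.of fun i => g (Pi.basisFun K m i), ?_, funext hg⟩
  exact Matrix.linearIndependent_rows_iff_isUnit.mp (he.map' g.toLinearMap g.ker)

variable {F σ k l m n m' n' : Type*}

/-- The product `R A` of a matrix `R` of constants with a matrix `A` of polynomials. -/
noncomputable def constMul [CommSemiring F] [Fintype m] (R : Matrix m' m F)
    (A : Matrix m n (MvPolynomial σ F)) : Matrix m' n (MvPolynomial σ F) :=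
  (R.map MvPolynomial.C : Matrix m' m (MvPolynomial σ F)) * A

section ConstMul

variable [CommSemiring F] [Fintype m]

theorem constMul_apply (R : Matrix m' m F) (A : Matrix m n (MvPolynomial σ F)) (i : m') (j : n) :
    constMul R A i j = ∑ k, MvPolynomial.C (R i k) * A k j :=
  Matrix.mul_apply

theorem constMul_one [DecidableEq m] (A : Matrix m n (MvPolynomial σ F)) : constMul 1 A = A := by
  rw [constMul, Matrix.map_one _ (map_zero _) (map_one _), Matrix.one_mul]

theorem constMul_mul [Fintype m'] (R' : Matrix k m' F) (R : Matrix m' m F)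
    (A : Matrix m n (MvPolynomial σ F)) : constMul (R' * R) A = constMul R' (constMul R A) := by
  simp only [constMul, Matrix.map_mul, Matrix.mul_assoc]

theorem constMul_submatrix_right (R : Matrix m' m F) (A : Matrix m n (MvPolynomial σ F))
    (c : n' → n) : constMul R (A.submatrix id c) = (constMul R A).submatrix id c :=
  rfl

theorem constMul_submatrix_left (R : Matrix m' m F) (A : Matrix m n (MvPolynomial σ F))
    (r : k → m') : constMul (R.submatrix r id) A = (constMul R A).submatrix r id :=
  rfl

end ConstMul

variable [Field F]

theorem IsACI.submatrix {A : Matrix m n (MvPolynomial σ F)} (hA : IsACI A) (r : m' → m)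
    {c : n' → n} (hc : Function.Injective c) : IsACI (A.submatrix r c) :=
  ⟨fun i j => hA.1 (r i) (c j), fun i i' _ _ hj => hA.2 (r i) (r i') _ _ (hc.ne hj)⟩

theorem isACI_constMul [Fintype m] {A : Matrix m n (MvPolynomial σ F)} (hA : IsACI A)
    (R : Matrix m' m F) : IsACI (constMul R A) := by
  classical
  have hvars (i : m') (j : n) :
      (constMul R A i j).vars ⊆ Finset.univ.biUnion fun k => (A k j).vars := by
    rw [constMul_apply]
    refine (MvPolynomial.vars_sum_subset _ _).trans (Finset.biUnion_mono fun k _ => ?_)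
    simpa using MvPolynomial.vars_mul (MvPolynomial.C (R i k)) (A k j)
  refine ⟨fun i j => ?_, fun i i' j j' hj => ?_⟩
  · rw [constMul_apply]
    refine MvPolynomial.totalDegree_finsetSum_le fun k _ => ?_
    simpa using (MvPolynomial.totalDegree_mul (MvPolynomial.C (R i k)) (A k j)).trans
      (add_le_add_right (hA.1 k j) _)
  · refine Disjoint.mono (hvars i j) (hvars i' j') ?_
    simp only [Finset.disjoint_biUnion_left, Finset.disjoint_biUnion_right]
    exact fun k _ k' _ => hA.2 _ _ _ _ hj

theorem completion_constMul [Fintype m] (R : Matrix m' m F) (A : Matrix m n (MvPolynomial σ F))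
    (x : σ → F) : completion (constMul R A) x = R * completion A x := by
  ext i j
  simp [completion, constMul_apply, Matrix.mul_apply]

theorem completion_submatrix (A : Matrix m n (MvPolynomial σ F)) (r : m' → m) (c : n' → n)
    (x : σ → F) : completion (A.submatrix r c) x = (completion A x).submatrix r c :=
  rfl

theorem hasConstantRank_congr [Fintype n] [Fintype n'] {A : Matrix m n (MvPolynomial σ F)}
    {B : Matrix m' n' (MvPolynomial σ F)}
    (h : ∀ x, (completion A x).rank = (completion B x).rank) (ρ : ℕ) :
    HasConstantRank A ρ ↔ HasConstantRank B ρ := by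
  simp only [HasConstantRank, rankSet, h]

theorem HasConstantRank.submatrix_equiv [Fintype n] [Fintype n']
    {A : Matrix m n (MvPolynomial σ F)} {ρ : ℕ} (hA : HasConstantRank A ρ) (e : m' ≃ m)
    (f : n' ≃ n) : HasConstantRank (A.submatrix e f) ρ :=
  (hasConstantRank_congr (fun x => Matrix.rank_submatrix (completion A x) e f) ρ).mpr hA

section Equivalent

variable [Fintype m] [DecidableEq m] [Fintype n] [DecidableEq n]
  {A B : Matrix m n (MvPolynomial σ F)}

theorem equivalent_iff_exists_submatrix :
    Equivalent A B ↔ ∃ (T : Matrix m m F) (q : Equiv.Perm n),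
      IsUnit T ∧ B = (constMul T A).submatrix id q := by
  have hmul (T : Matrix m m F) (q : Equiv.Perm n) :
      constMul T A * (q.permMatrix (MvPolynomial σ F) : Matrix n n (MvPolynomial σ F)) =
        (constMul T A).submatrix id q.symm :=
    PEquiv.mul_toMatrix_toPEquiv _ _
  constructor
  · rintro ⟨T, q, hT, rfl⟩
    exact ⟨T, q.symm, hT, hmul T q⟩
  · rintro ⟨T, q, hT, rfl⟩
    exact ⟨T, q.symm, hT, hmul T q.symm⟩

theorem Equivalent.rank_completion (h : Equivalent A B) (x : σ → F) :
    (completion B x).rank = (completion A x).rank := by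
  obtain ⟨T, q, hT, rfl⟩ := equivalent_iff_exists_submatrix.mp h
  calc (completion ((constMul T A).submatrix id q) x).rank
      = ((completion (constMul T A) x).submatrix (Equiv.refl m) q).rank := by
        rw [completion_submatrix, Equiv.coe_refl]
    _ = (completion (constMul T A) x).rank := Matrix.rank_submatrix _ _ _
    _ = (T * completion A x).rank := by rw [completion_constMul]
    _ = (completion A x).rank :=
      Matrix.rank_mul_eq_right_of_isUnit_det _ _ ((Matrix.isUnit_iff_isUnit_det T).mp hT)

theorem Equivalent.hasConstantRank {ρ : ℕ} (h : Equivalent A B) (hA : HasConstantRank A ρ) :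
    HasConstantRank B ρ :=
  (hasConstantRank_congr h.rank_completion ρ).mpr hA

end Equivalent

/-- `A'` is a compression of `A`: it consists of distinct columns of `R A` for a constant matrix `R`
with linearly independent rows. Up to the position of the block, these are the blocks of the
matrices equivalent to `A`, but in this form transitivity is immediate. -/
def IsCompression [Fintype m] (A' : Matrix m' n' (MvPolynomial σ F))
    (A : Matrix m n (MvPolynomial σ F)) : Prop :=
  ∃ (R : Matrix m' m F) (c : n' → n), LinearIndependent F R.row ∧ Function.Injective c ∧
    A' = (constMul R A).submatrix id c

section Compression

variable [Fintype m] {A : Matrix m n (MvPolynomial σ F)}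

theorem isCompression_submatrix {r : m' → m} {c : n' → n} (hr : Function.Injective r)
    (hc : Function.Injective c) : IsCompression (A.submatrix r c) A := by
  classical
  refine ⟨(1 : Matrix m m F).submatrix r id, c, ?_, hc, ?_⟩
  · exact (Matrix.linearIndependent_rows_of_isUnit (isUnit_one (M := Matrix m m F))).comp r hr
  · rw [constMul_submatrix_left, constMul_one, Matrix.submatrix_submatrix]
    rfl

theorem IsCompression.refl (A : Matrix m n (MvPolynomial σ F)) : IsCompression A A :=
  isCompression_submatrix Function.injective_id Function.injective_id

theorem IsCompression.trans [Fintype m'] {A' : Matrix m' n' (MvPolynomial σ F)}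
    {A'' : Matrix k l (MvPolynomial σ F)} (h' : IsCompression A'' A') (h : IsCompression A' A) :
    IsCompression A'' A := by
  obtain ⟨R, c, hR, hc, rfl⟩ := h
  obtain ⟨R', c', hR', hc', rfl⟩ := h'
  refine ⟨R' * R, c ∘ c', ?_, hc.comp hc', ?_⟩
  · exact hR'.map_injOn R.vecMulLinear (Matrix.vecMul_injective_iff.mpr hR).injOn
  · rw [constMul_submatrix_right, constMul_mul, Matrix.submatrix_submatrix]
    rfl

theorem Equivalent.isCompression [DecidableEq m] [Fintype n] [DecidableEq n]
    {B : Matrix m n (MvPolynomial σ F)} (h : Equivalent A B) : IsCompression B A := by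
  obtain ⟨T, q, hT, rfl⟩ := equivalent_iff_exists_submatrix.mp h
  exact ⟨T, q, Matrix.linearIndependent_rows_of_isUnit hT, q.injective, rfl⟩

theorem IsCompression.isACI {A' : Matrix m' n' (MvPolynomial σ F)} (h : IsCompression A' A)
    (hA : IsACI A) : IsACI A' := by
  obtain ⟨R, c, -, hc, rfl⟩ := h
  exact (isACI_constMul hA R).submatrix id hc

theorem IsCompression.exists_equivalent_submatrix_eq [DecidableEq m] [Fintype n] [DecidableEq n]
    {A' : Matrix m' n' (MvPolynomial σ F)} (h : IsCompression A' A) {r : m' → m} {s : n' → n}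
    (hr : Function.Injective r) (hs : Function.Injective s) :
    ∃ B, Equivalent A B ∧ A' = B.submatrix r s := by
  obtain ⟨R, c, hR, hc, rfl⟩ := h
  obtain ⟨T, hT, rfl⟩ := exists_isUnit_submatrix_eq hR hr
  have : Finite n' := Finite.of_injective c hc
  obtain ⟨q, hq⟩ := Equiv.Perm.exists_extending_pair s c hs hc
  refine ⟨_, equivalent_iff_exists_submatrix.mpr ⟨T, q, hT, rfl⟩, ?_⟩
  have hqs : q ∘ s = c := funext hq
  rw [constMul_submatrix_left, Matrix.submatrix_submatrix, Matrix.submatrix_submatrix, hqs]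
  rfl

theorem IsCompression.card_rows_le [Fintype m'] {A' : Matrix m' n' (MvPolynomial σ F)}
    (h : IsCompression A' A) : Fintype.card m' ≤ Fintype.card m := by
  obtain ⟨R, -, hR, -⟩ := h
  simpa using hR.fintype_card_le_finrank

theorem IsCompression.card_cols_le [Fintype n] [Fintype n']
    {A' : Matrix m' n' (MvPolynomial σ F)} (h : IsCompression A' A) :
    Fintype.card n' ≤ Fintype.card n := by
  obtain ⟨-, c, -, hc, -⟩ := h
  exact Fintype.card_le_of_injective c hc

theorem IsCompression.exists_isUpperLeftBlock {m n m' n' : ℕ}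
    {A : Matrix (Fin m) (Fin n) (MvPolynomial σ F)}
    {A' : Matrix (Fin m') (Fin n') (MvPolynomial σ F)} (h : IsCompression A' A) :
    ∃ B, Equivalent A B ∧ IsUpperLeftBlock A' B := by
  have hm : m' ≤ m := by simpa using h.card_rows_le
  have hn : n' ≤ n := by simpa using h.card_cols_le
  obtain ⟨B, hAB, hA'⟩ :=
    h.exists_equivalent_submatrix_eq (Fin.castLE_injective hm) (Fin.castLE_injective hn)
  exact ⟨B, hAB, hm, hn, hA'⟩

end Compression

theorem isCompletelyIrreducible_of_forall_not_hasConstantRank [Fintype m] [DecidableEq m]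
    [Fintype n] [DecidableEq n] {A : Matrix m n (MvPolynomial σ F)} {ρ : ℕ} (hA : IsACI A)
    (hρ : HasConstantRank A ρ)
    (hrow : ∀ i : m, ∀ D : Matrix {k // k ≠ i} n (MvPolynomial σ F),
      IsCompression D A → ¬ HasConstantRank D ρ)
    (hcol : ∀ j : n, ∀ D : Matrix m {k // k ≠ j} (MvPolynomial σ F),
      IsCompression D A → ¬ HasConstantRank D ρ) :
    IsCompletelyIrreducible A ρ := by
  refine ⟨hA, hρ, fun B hB hAB => ⟨hB, hAB.hasConstantRank hρ, ?_, ?_⟩⟩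
  · rintro ⟨-, i, hi⟩
    have hrB : IsCompression (deleteRow B i) B :=
      isCompression_submatrix Subtype.val_injective Function.injective_id
    exact hrow i _ (hrB.trans hAB.isCompression) hi
  · rintro ⟨-, j, hj⟩
    have hcB : IsCompression (deleteCol B j) B :=
      isCompression_submatrix Function.injective_id Subtype.val_injective
    exact hcol j _ (hcB.trans hAB.isCompression) hj

theorem IsCompression.exists_fin [Fintype m] [Fintype k] [Fintype l]
    {A : Matrix m n (MvPolynomial σ F)} {D : Matrix k l (MvPolynomial σ F)} {ρ : ℕ}
    (h : IsCompression D A) (hD : HasConstantRank D ρ) :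
    ∃ D' : Matrix (Fin (Fintype.card k)) (Fin (Fintype.card l)) (MvPolynomial σ F),
      IsCompression D' A ∧ HasConstantRank D' ρ := by
  let e := (Fintype.equivFin k).symm
  let f := (Fintype.equivFin l).symm
  exact ⟨D.submatrix e f, (isCompression_submatrix e.injective f.injective).trans h,
    hD.submatrix_equiv e f⟩

theorem isCompletelyIrreducible_of_minimal {m n : ℕ}
    {A : Matrix (Fin m) (Fin n) (MvPolynomial σ F)} {ρ : ℕ} (hA : IsACI A)
    (hρ : HasConstantRank A ρ)
    (hmin : ∀ (k l : ℕ) (D : Matrix (Fin k) (Fin l) (MvPolynomial σ F)),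
      IsCompression D A → HasConstantRank D ρ → m + n ≤ k + l) :
    IsCompletelyIrreducible A ρ := by
  refine isCompletelyIrreducible_of_forall_not_hasConstantRank hA hρ ?_ ?_
  · intro i D hDA hD
    obtain ⟨D', hD'A, hD'⟩ := hDA.exists_fin hD
    have hle := hmin _ _ D' hD'A hD'
    have hlt : Fintype.card {k // k ≠ i} < m := by
      simpa using Fintype.card_subtype_lt (p := (· ≠ i)) (x := i) (by simp)
    rw [Fintype.card_fin n] at hle
    omega
  · intro j D hDA hD
    obtain ⟨D', hD'A, hD'⟩ := hDA.exists_fin hD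
    have hle := hmin _ _ D' hD'A hD'
    have hlt : Fintype.card {k // k ≠ j} < n := by
      simpa using Fintype.card_subtype_lt (p := (· ≠ j)) (x := j) (by simp)
    rw [Fintype.card_fin m] at hle
    omega

theorem exists_isCompression_isCompletelyIrreducible {m n ρ : ℕ}
    {A : Matrix (Fin m) (Fin n) (MvPolynomial σ F)} (hA : IsACI A) (hρ : HasConstantRank A ρ) :
    ∃ (m' n' : ℕ) (A' : Matrix (Fin m') (Fin n') (MvPolynomial σ F)),
      IsCompression A' A ∧ IsCompletelyIrreducible A' ρ := by
  classical
  have hsize : ∃ N k l, ∃ D : Matrix (Fin k) (Fin l) (MvPolynomial σ F),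
      k + l = N ∧ IsCompression D A ∧ HasConstantRank D ρ :=
    ⟨m + n, m, n, A, rfl, IsCompression.refl A, hρ⟩
  obtain ⟨m', n', A', hN, hA'A, hA'⟩ := Nat.find_spec hsize
  refine ⟨m', n', A', hA'A, isCompletelyIrreducible_of_minimal (hA'A.isACI hA) hA' ?_⟩
  intro k l D hDA' hD
  exact hN.trans_le (Nat.find_min' hsize ⟨k, l, D, rfl, hDA'.trans hA'A, hD⟩)

end ACI

theorem mainTheorem4 {F σ : Type*} [Field F] {m n : ℕ} (ρ : ℕ)
    (A : Matrix (Fin m) (Fin n) (MvPolynomial σ F))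
    (hA : ACI.IsACI A) (hρ : ACI.HasConstantRank A ρ) :
    ∃ (m' n' : ℕ) (A' : Matrix (Fin m') (Fin n') (MvPolynomial σ F)), ACI.IsCore A' A ρ := by
  obtain ⟨m', n', A', hA'A, hA'⟩ := ACI.exists_isCompression_isCompletelyIrreducible hA hρ
  obtain ⟨B, hAB, hblock⟩ := hA'A.exists_isUpperLeftBlock
  exact ⟨m', n', A', ⟨B, hAB.isCompression.isACI hA, hAB, hblock⟩, hA'⟩
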